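/- All Banach spaces are real. Let $B$ be a Banach space and $k\ge 1$. The projective tensor power $B^{\hat\otimes k}$ is the completion of the algebraic tensor power $B^{\otimes k}$ in the norm $\|u\|_\pi=\inf\{\sum_j\|x_{1j}\|\cdots\|x_{kj}\| : u=\sum_j x_{1j}\otimes\cdots\otimes x_{kj}\}$ (finite sums). The injective tensor power $B^{\check\otimes k}$ is the completion of $B^{\otimes k}$ in the norm $\|u\|_\varepsilon=\sup\{|u(x_1^*,\dots,x_k^*)| : x_i^*\in B^*,\ \|x_i^*\|\le 1\}$, where $x_1\otimes\cdots\otimes x_k$ is regarded as the $k$-linear form $(x_1^*,\dots,x_k^*)\mapsto x_1^*(x_1)\cdots x_k^*(x_k)$ on $B^*$; equivalently, it is the closure of $B^{\otimes k}$ in the space of bounded $k$-linear forms on $B^*$. Let $(\Omega,\mathcal F,\mathbb P)$ be a probability space. A function $Y:\Omega\to E$ into a Banach space is *Dunford integrable* if $\varphi(Y)$ is integrable for every $\varphi\in E^*$ (its Dunford integral is then $\varphi\mapsto\mathbb E\,\varphi(Y)$, an element of $E^{**}$); it is *Pettis integrable* if it is Dunford integrable and for every event $A$ there is $y_A\in E$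 with $\varphi(y_A)=\mathbb E(\mathbf 1_A\varphi(Y))$ for all $\varphi\in E^*$; and *Bochner integrable* has its usual meaning. For $X:\Omega\to B$, the projective moment $\mathbb E X^{\hat\otimes k}$ (respectively the injective moment $\mathbb E X^{\check\otimes k}$) exists in the Dunford, Pettis or Bochner sense if $X^{\otimes k}=X\otimes\cdots\otimes X$, as a function into $B^{\hat\otimes k}$ (respectively $B^{\check\otimes k}$), is integrable in that sense. The weak $k$-th moment exists if $x_1^*(X)\cdots x_k^*(X)$ is integrable for all $x_1^*,\dots,x_k^*\in B^*$. A family $\{\xi_\alpha\}$ of real random variables is uniformly integrable if $\sup_\alpha\mathbb E|\xi_\alpha|<\infty$ and $\sup_\alpha\mathbb E(\mathbf 1_A|\xi_\alpha|)\to 0$ as $\mathbb P(A)\to 0$. **Theorem.** Let $K$ be a metrizable compact space, let $C(K)$ be the space of continuous functions $K\to\mathbb R$ with the supremum norm, and let $X:\Omega\to C(K)$ be $\mathcal C$-measurable, i.e. $X(t)$ is a (measurable) real random variable for every $t\in K$. Then: (i) $\mathbb E X^{\hat\otimes 2}$ exists in Dunford sense $\iff$ $\mathbb E X^{\check\otimes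 2}$ exists in Dunford sense $\iff$ the weak second moment of $X$ exists $\iff$ $\sup_{t\in K}\mathbb E|X(t)|^2<\infty$. (ii) $\mathbb E X^{\hat\otimes 2}$ exists in Pettis sense $\iff$ $\mathbb E X^{\check\otimes 2}$ exists in Pettis sense $\iff$ the family $\{|X(t)|^2 : t\in K\}$ is uniformly integrable. (iii) $\mathbb E X^{\hat\otimes 2}$ exists in Bochner sense $\iff$ $\mathbb E X^{\check\otimes 2}$ exists in Bochner sense $\iff$ $\mathbb E\bigl[(\sup_{t\in K}|X(t)|)^2\bigr]<\infty$. -/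

import Mathlib

open MeasureTheory
open scoped TensorProduct ENNReal

set_option maxSynthPendingDepth 3

noncomputable section

namespace BanachMoment

section TensorPowers

variable (k : ℕ) (B : Type*) [NormedAddCommGroup B] [NormedSpace ℝ B]

/-- The `k`-fold projective tensor power of `B`: the completion of the algebraic tensor power,
whose Mathlib norm is the projective tensor norm
`‖u‖ = inf {∑ j, ∏ i, ‖x i j‖ : u = ∑ j, x 1 j ⊗ ⋯ ⊗ x k j}`. -/
abbrev ProjTensorPower : Type _ :=
  UniformSpace.Completion (⨂[ℝ] _ : Fin k, B)

variable {k B} in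
/-- The elementary tensor `x 1 ⊗ ⋯ ⊗ x k` as the bounded `k`-linear form
`(φ 1, …, φ k) ↦ φ 1 (x 1) ⋯ φ k (x k)` on the dual space of `B`. -/
def elementaryForm (x : Fin k → B) :
    ContinuousMultilinearMap ℝ (fun _ : Fin k => StrongDual ℝ B) ℝ :=
  (ContinuousMultilinearMap.mkPiAlgebra ℝ (Fin k) ℝ).compContinuousLinearMap
    fun i => NormedSpace.inclusionInDoubleDual ℝ B (x i)

/-- The `k`-fold injective tensor power of `B`: the closure, in the Banach space of bounded
`k`-linear forms on the dual of `B`, of the linear span of the elementary tensors; its norm is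
the one induced by the norm
`‖u‖ = sup {|u (φ 1, …, φ k)| : ‖φ 1‖, …, ‖φ k‖ ≤ 1}` of bounded `k`-linear forms. -/
def injTensorPower :
    Submodule ℝ (ContinuousMultilinearMap ℝ (fun _ : Fin k => StrongDual ℝ B) ℝ) :=
  (Submodule.span ℝ (Set.range (elementaryForm (k := k) (B := B)))).topologicalClosure

variable {B}

/-- `x ⊗ ⋯ ⊗ x` (`k` factors) as an element of the projective tensor power. -/
def projPow (x : B) : ProjTensorPower k B :=
  ((⨂ₜ[ℝ] _ : Fin k, x : ⨂[ℝ] _ : Fin k, B) : UniformSpace.Completion (⨂[ℝ] _ : Fin k, B))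

/-- `x ⊗ ⋯ ⊗ x` (`k` factors) as an element of the injective tensor power. -/
def injPow (x : B) : injTensorPower k B :=
  ⟨elementaryForm fun _ => x,
    Submodule.le_topologicalClosure _ (Submodule.subset_span ⟨fun _ => x, rfl⟩)⟩

theorem elementaryForm_apply (x : Fin k → B) (φ : Fin k → StrongDual ℝ B) :
    elementaryForm x φ = ∏ i, φ i (x i) := by
  simp [elementaryForm]

end TensorPowers

section Integrals

variable {Ω : Type*} [MeasurableSpace Ω]
  {E : Type*} [NormedAddCommGroup E] [NormedSpace ℝ E]

/-- `Y` is Dunford integrable: `φ(Y)` is integrable for every `φ` in the dual space (the Dunford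
integral is then the element `φ ↦ 𝔼 φ(Y)` of the bidual). -/
def DunfordIntegrable (Y : Ω → E) (P : Measure Ω) : Prop :=
  ∀ φ : StrongDual ℝ E, Integrable (fun ω => φ (Y ω)) P

/-- `Y` is Pettis integrable: it is Dunford integrable and, for every event `A` (in particular for
the whole space), the Dunford integral of `Y 1_A` is an element of the space itself. -/
def PettisIntegrable (Y : Ω → E) (P : Measure Ω) : Prop :=
  DunfordIntegrable Y P ∧
    ∀ A : Set Ω, MeasurableSet A → ∃ y : E, ∀ φ : StrongDual ℝ E, φ y = ∫ ω in A, φ (Y ω) ∂P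

/-- `Y` is Bochner integrable. -/
def BochnerIntegrable (Y : Ω → E) (P : Measure Ω) : Prop :=
  Integrable Y P

end Integrals

/-- The weak `k`-th moment of `X` exists: `𝔼 (φ 1 (X) ⋯ φ k (X))` exists for all `φ 1, …, φ k` in
the dual space. -/
def WeakMomentExists (k : ℕ) {Ω : Type*} [MeasurableSpace Ω]
    {B : Type*} [NormedAddCommGroup B] [NormedSpace ℝ B] (X : Ω → B) (P : Measure Ω) : Prop :=
  ∀ φ : Fin k → StrongDual ℝ B, Integrable (fun ω => ∏ i, φ i (X ω)) P

end BanachMoment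

end

/-!
The implications from the projective to the injective tensor square, and from there to the weak
second moment, come from bounded linear maps. The theorem says that for `C(K)` they can be reversed.
The reason is Grothendieck's inequality: for a bounded bilinear form `A` on `C(K)` and finitely many
`y k`,
`∑ k, |A (y k) (y k)| ≤ 8 ‖A‖ sup_t ∑ k, (y k t)²` (`sum_abs_bilin_self_le`).
With weights given by probabilities, and after approximation by simple functions, it becomes
`𝔼 (1_s |Φ(X ⊗ X)|) ≤ 8 ‖Φ‖ sup_t 𝔼 (1_s |X(t)|²)` for every functional `Φ` on the projective
tensor square (`lintegral_bilin_self_le`, `BanachMoment.lintegral_dual_projPow_le`). So bounded second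
moments of the point values give Dunford integrability, and uniform integrability of the squares
makes the variables `Φ(X ⊗ X)`, `‖Φ‖ ≤ 1`, uniformly integrable, which for the strongly measurable
function `X ⊗ X` gives Pettis integrability (`BanachMoment.DunfordIntegrable.pettisIntegrable`).

Grothendieck's inequality is proved first for matrices: vectors are represented by Rademacher sums,
cut at twice their standard deviation, and the remainders are absorbed
(`GrothendieckBound.improve`). A partition of unity carries it over to `C(K)`.

Conversely, a weak second moment is bounded on the unit ball of the dual, by the closed graph theorem
(`BanachMoment.exists_lintegral_sq_le_of_weakMomentExists`), and a Pettis integrable injective square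
makes all functions `t ↦ 𝔼 (1_s |X(t)|²)` continuous, so that Dini's theorem gives uniform
integrability (`BanachMoment.PettisIntegrable.unifIntegrable_of_injPow`). In the Bochner case
both norms of `X ⊗ X` equal `‖X‖²`, and `X` is strongly measurable because `K` is metrizable
(`stronglyMeasurable_of_eval`).
-/

/-! ### Grothendieck's inequality for matrices -/

/-- The Rademacher sum `∑ k, ± u k`, with signs given by a point of the cube `Fin n → Bool`. -/
noncomputable def rademacherSum {n : ℕ} (u : Fin n → ℝ) (ω : Fin n → Bool) : ℝ :=
  ∑ k, if ω k then u k else -u k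

theorem sum_bool_cube_succ {n : ℕ} (f : (Fin (n + 1) → Bool) → ℝ) :
    ∑ ω, f ω = ∑ ω : Fin n → Bool, (f (Fin.cons true ω) + f (Fin.cons false ω)) := by
  rw [← (Fin.consEquiv fun _ : Fin (n + 1) => Bool).sum_comp, Fintype.sum_prod_type,
    Fintype.sum_bool, ← Finset.sum_add_distrib]
  rfl

theorem rademacherSum_cons {n : ℕ} (u : Fin (n + 1) → ℝ) (b : Bool) (ω : Fin n → Bool) :
    rademacherSum u (Fin.cons b ω : Fin (n + 1) → Bool) =
      (if b then u 0 else -u 0) + rademacherSum (fun k => u k.succ) ω := by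
  simp [rademacherSum, Fin.sum_univ_succ]

/-- Orthogonality of the Rademacher functions. -/
theorem sum_rademacherSum_mul {n : ℕ} (u v : Fin n → ℝ) :
    ∑ ω, rademacherSum u ω * rademacherSum v ω = 2 ^ n * ∑ k, u k * v k := by
  induction n with
  | zero => simp [rademacherSum]
  | succ n ih =>
    rw [sum_bool_cube_succ, Fin.sum_univ_succ, mul_add, pow_succ]
    have h := ih (fun k => u k.succ) (fun k => v k.succ)
    calc _ = ∑ ω : Fin n → Bool, (2 * (u 0 * v 0) +
          2 * (rademacherSum (fun k => u k.succ) ω * rademacherSum (fun k => v k.succ) ω)) := by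
          refine Finset.sum_congr rfl fun ω _ => ?_
          simp only [rademacherSum_cons]
          simp only [if_true, Bool.false_eq_true, if_false]
          ring
      _ = _ := by
          simp only [Finset.sum_add_distrib, ← Finset.mul_sum, h]
          simp
          ring

theorem sum_rademacherSum_sq {n : ℕ} (u : Fin n → ℝ) :
    ∑ ω, rademacherSum u ω ^ 2 = 2 ^ n * ∑ k, u k ^ 2 := by
  simpa only [sq] using sum_rademacherSum_mul u u

/-- Khinchine's inequality for the fourth moment. -/
theorem sum_rademacherSum_pow_four_le {n : ℕ} (u : Fin n → ℝ) :
    ∑ ω, rademacherSum u ω ^ 4 ≤ 2 ^ n * (3 * (∑ k, u k ^ 2) ^ 2) := by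
  induction n with
  | zero => simp [rademacherSum]
  | succ n ih =>
    rw [sum_bool_cube_succ, Fin.sum_univ_succ]
    set v : Fin n → ℝ := fun k => u k.succ
    have h2 := sum_rademacherSum_sq v
    have h4 := ih v
    have : ∑ ω : Fin n → Bool, (rademacherSum u (Fin.cons true ω : Fin (n + 1) → Bool) ^ 4 +
        rademacherSum u (Fin.cons false ω : Fin (n + 1) → Bool) ^ 4) =
        2 ^ n * (2 * u 0 ^ 4) + 12 * u 0 ^ 2 * ∑ ω, rademacherSum v ω ^ 2 +
          2 * ∑ ω, rademacherSum v ω ^ 4 := by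
      calc _ = ∑ ω : Fin n → Bool, (2 * u 0 ^ 4 + 12 * u 0 ^ 2 * rademacherSum v ω ^ 2 +
            2 * rademacherSum v ω ^ 4) := by
            refine Finset.sum_congr rfl fun ω _ => ?_
            simp only [rademacherSum_cons]
            simp only [if_true, Bool.false_eq_true, if_false]
            ring
        _ = _ := by
            simp only [Finset.sum_add_distrib, ← Finset.mul_sum]
            simp
            ring
    rw [this, h2]
    change _ ≤ 2 ^ (n + 1) * (3 * (u 0 ^ 2 + ∑ k, v k ^ 2) ^ 2)
    have h0 : 0 ≤ (2 : ℝ) ^ n * u 0 ^ 4 := by positivity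
    rw [pow_succ (2 : ℝ) n]
    nlinarith [h4, h0]

/-- Truncation of a real number to the interval `[-m, m]`. -/
noncomputable def truncAt (m x : ℝ) : ℝ := max (-m) (min m x)

theorem abs_truncAt_le {m : ℝ} (hm : 0 ≤ m) (x : ℝ) : |truncAt m x| ≤ m := by
  rw [truncAt, abs_le]
  exact ⟨le_max_left _ _, max_le (by linarith) (min_le_left _ _)⟩

theorem sq_truncAt_le {m : ℝ} (hm : 0 ≤ m) (x : ℝ) : truncAt m x ^ 2 ≤ x ^ 2 := by
  rw [sq_le_sq, truncAt]
  grind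

theorem sq_sub_truncAt_le {m : ℝ} (hm : 0 ≤ m) (x : ℝ) :
    16 * m ^ 2 * (x - truncAt m x) ^ 2 ≤ x ^ 4 := by
  have h : 4 * m * |x - truncAt m x| ≤ x ^ 2 := by
    rcases le_or_gt |x| m with h | h
    · have : truncAt m x = x := by rw [truncAt]; grind
      rw [this]; simp; positivity
    · have : |x - truncAt m x| = |x| - m := by rw [truncAt]; grind
      rw [this]
      nlinarith [sq_nonneg (|x| - 2 * m), sq_abs x]
  have h' := pow_le_pow_left₀ (by positivity) h 2
  calc _ = (4 * m * |x - truncAt m x|) ^ 2 := by rw [mul_pow, sq_abs]; ring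
    _ ≤ _ := h'
    _ = _ := by ring

section

variable {I J : Type*} [Fintype I] [Fintype J]

/-- `B` is a Grothendieck constant of the matrix `a`: the bilinear form of `a`, evaluated on
vectors of a Euclidean space of arbitrary dimension whose squared lengths are at most `S`, is at
most `B * S`. -/
def GrothendieckBound (a : I → J → ℝ) (B : ℝ) : Prop :=
  ∀ (n : ℕ) (S : ℝ), 0 < S → ∀ (u : I → Fin n → ℝ) (v : J → Fin n → ℝ),
    (∀ i, ∑ k, u i k ^ 2 ≤ S) → (∀ j, ∑ k, v j k ^ 2 ≤ S) →
    ∑ i, ∑ j, a i j * ∑ k, u i k * v j k ≤ B * S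

theorem GrothendieckBound.apply {a : I → J → ℝ} {B : ℝ} (h : GrothendieckBound a B)
    {N : Type*} [Fintype N] {S : ℝ} (hS : 0 < S) (u : I → N → ℝ) (v : J → N → ℝ)
    (hu : ∀ i, ∑ k, u i k ^ 2 ≤ S) (hv : ∀ j, ∑ k, v j k ^ 2 ≤ S) :
    ∑ i, ∑ j, a i j * ∑ k, u i k * v j k ≤ B * S := by
  let e := (Fintype.equivFin N).symm
  have := h (Fintype.card N) S hS (fun i k => u i (e k)) (fun j k => v j (e k))
    (fun i => by rw [e.sum_comp fun k => u i k ^ 2]; exact hu i)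
    (fun j => by rw [e.sum_comp fun k => v j k ^ 2]; exact hv j)
  refine le_trans (le_of_eq ?_) this
  refine Finset.sum_congr rfl fun i _ => Finset.sum_congr rfl fun j _ => ?_
  rw [e.sum_comp fun k => u i k * v j k]

/-- A crude a priori bound, which depends on the matrix but not on the dimension of the vectors. -/
theorem grothendieckBound_sum_abs (a : I → J → ℝ) :
    GrothendieckBound a (∑ i, ∑ j, |a i j|) := by
  intro n S hS u v hu hv
  rw [Finset.sum_mul]
  refine Finset.sum_le_sum fun i _ => ?_
  rw [Finset.sum_mul]
  refine Finset.sum_le_sum fun j _ => ?_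
  refine (le_abs_self _).trans ?_
  rw [abs_mul]
  refine mul_le_mul_of_nonneg_left ?_ (abs_nonneg _)
  have h1 : ∑ k, u i k * v j k ≤ S := by
    have : ∑ k, u i k * v j k ≤ ∑ k, (u i k ^ 2 + v j k ^ 2) / 2 :=
      Finset.sum_le_sum fun k _ => by nlinarith [sq_nonneg (u i k - v j k)]
    rw [← Finset.sum_div, Finset.sum_add_distrib] at this
    linarith [hu i, hv j]
  have h2 : ∑ k, -(u i k * v j k) ≤ S := by
    have : ∑ k, -(u i k * v j k) ≤ ∑ k, (u i k ^ 2 + v j k ^ 2) / 2 :=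
      Finset.sum_le_sum fun k _ => by nlinarith [sq_nonneg (u i k + v j k)]
    rw [← Finset.sum_div, Finset.sum_add_distrib] at this
    linarith [hu i, hv j]
  rw [Finset.sum_neg_distrib] at h2
  rw [abs_le]
  constructor <;> linarith

theorem sum_mul_mul_le_of_abs_le {a : I → J → ℝ} {c : ℝ}
    (ha : ∀ (s : I → ℝ) (t : J → ℝ), (∀ i, |s i| ≤ 1) → (∀ j, |t j| ≤ 1) →
      ∑ i, ∑ j, a i j * (s i * t j) ≤ c)
    {m : ℝ} (hm : 0 < m) (s : I → ℝ) (t : J → ℝ) (hs : ∀ i, |s i| ≤ m) (ht : ∀ j, |t j| ≤ m) :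
    ∑ i, ∑ j, a i j * (s i * t j) ≤ c * m ^ 2 := by
  have := ha (fun i => s i / m) (fun j => t j / m)
    (fun i => by rw [abs_div, abs_of_pos hm, div_le_one hm]; exact hs i)
    (fun j => by rw [abs_div, abs_of_pos hm, div_le_one hm]; exact ht j)
  rw [← div_le_iff₀ (by positivity), Finset.sum_div]
  refine le_trans (le_of_eq ?_) this
  refine Finset.sum_congr rfl fun i _ => ?_
  rw [Finset.sum_div]
  refine Finset.sum_congr rfl fun j _ => ?_
  field_simp

/-- The self-improvement behind Grothendieck's inequality: vectors are represented by Rademacher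
sums, which are cut at twice their standard deviation. The cut parts are scalars, for which the
hypothesis on `a` applies; the remainders have small norm, and for them the bound `B` is used. -/
theorem GrothendieckBound.improve {a : I → J → ℝ} {B c : ℝ}
    (ha : ∀ (s : I → ℝ) (t : J → ℝ), (∀ i, |s i| ≤ 1) → (∀ j, |t j| ≤ 1) →
      ∑ i, ∑ j, a i j * (s i * t j) ≤ c)
    (h : GrothendieckBound a B) : GrothendieckBound a (4 * c + B / 2) := by
  intro n S hS u v hu hv
  set m : ℝ := 2 * √S with hm
  have hm0 : 0 < m := by positivity
  have hmS : m ^ 2 = 4 * S := by rw [hm, mul_pow, Real.sq_sqrt hS.le]; norm_num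
  set Y : I → (Fin n → Bool) → ℝ := fun i => rademacherSum (u i)
  set Z : J → (Fin n → Bool) → ℝ := fun j => rademacherSum (v j)
  have h2 : (0 : ℝ) < 2 ^ n := by positivity
  have hsq : ∀ w : Fin n → ℝ, ∑ k, w k ^ 2 ≤ S → ∑ ω, rademacherSum w ω ^ 2 ≤ 2 ^ n * S :=
    fun w hw => by
      rw [sum_rademacherSum_sq]; exact mul_le_mul_of_nonneg_left hw h2.le
  have htr : ∀ w : Fin n → ℝ, ∑ k, w k ^ 2 ≤ S →
      ∑ ω, truncAt m (rademacherSum w ω) ^ 2 ≤ 2 ^ n * S :=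
    fun w hw => (Finset.sum_le_sum fun ω _ => sq_truncAt_le hm0.le _).trans (hsq w hw)
  have hre : ∀ w : Fin n → ℝ, ∑ k, w k ^ 2 ≤ S →
      ∑ ω, (4 * (rademacherSum w ω - truncAt m (rademacherSum w ω))) ^ 2 ≤ 2 ^ n * S := by
    intro w hw
    have h4 : ∑ ω, rademacherSum w ω ^ 4 ≤ 2 ^ n * (3 * S ^ 2) := by
      refine (sum_rademacherSum_pow_four_le w).trans ?_
      have : 0 ≤ ∑ k, w k ^ 2 := by positivity
      gcongr
    have h5 : 16 * m ^ 2 * ∑ ω, (rademacherSum w ω - truncAt m (rademacherSum w ω)) ^ 2 ≤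
        2 ^ n * (3 * S ^ 2) := by
      rw [Finset.mul_sum]
      exact (Finset.sum_le_sum fun ω _ => sq_sub_truncAt_le hm0.le _).trans h4
    simp only [mul_pow, ← Finset.mul_sum]
    rw [hmS] at h5
    set q := ∑ ω, (rademacherSum w ω - truncAt m (rademacherSum w ω)) ^ 2
    have h6 : S * (64 * q) ≤ S * (2 ^ n * (3 * S)) := by linarith
    have h7 := le_of_mul_le_mul_left h6 hS
    have h8 : 0 ≤ 2 ^ n * S := by positivity
    linarith
  have hT : 0 < 2 ^ n * S := by positivity
  have hB := h.apply hT (fun i ω => 4 * (Y i ω - truncAt m (Y i ω))) Z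
    (fun i => hre _ (hu i)) (fun j => hsq _ (hv j))
  have hB' := h.apply hT (fun i ω => truncAt m (Y i ω)) (fun j ω => 4 * (Z j ω - truncAt m (Z j ω)))
    (fun i => htr _ (hu i)) (fun j => hre _ (hv j))
  have hC : ∑ ω : Fin n → Bool, ∑ i, ∑ j, a i j * (truncAt m (Y i ω) * truncAt m (Z j ω)) ≤
      2 ^ n * (c * m ^ 2) := by
    refine (Finset.sum_le_sum fun ω _ => sum_mul_mul_le_of_abs_le ha hm0 _ _
      (fun i => abs_truncAt_le hm0.le _) (fun j => abs_truncAt_le hm0.le _)).trans ?_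
    simp
  have hC' : ∑ ω : Fin n → Bool, ∑ i, ∑ j, a i j * (truncAt m (Y i ω) * truncAt m (Z j ω)) =
      ∑ i, ∑ j, a i j * ∑ ω : Fin n → Bool, truncAt m (Y i ω) * truncAt m (Z j ω) := by
    rw [Finset.sum_comm]
    refine Finset.sum_congr rfl fun i _ => ?_
    rw [Finset.sum_comm]
    exact Finset.sum_congr rfl fun j _ => by rw [Finset.mul_sum]
  rw [hC'] at hC
  have key : 2 ^ n * ∑ i, ∑ j, a i j * ∑ k, u i k * v j k =
      ∑ i, ∑ j, a i j * ∑ ω : Fin n → Bool, truncAt m (Y i ω) * truncAt m (Z j ω) +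
      (1 / 4) * ∑ i, ∑ j, a i j * ∑ ω, 4 * (Y i ω - truncAt m (Y i ω)) * Z j ω +
      (1 / 4) * ∑ i, ∑ j, a i j * ∑ ω, truncAt m (Y i ω) * (4 * (Z j ω - truncAt m (Z j ω))) := by
    simp only [Finset.mul_sum, ← Finset.sum_add_distrib]
    refine Finset.sum_congr rfl fun i _ => Finset.sum_congr rfl fun j _ => ?_
    have := sum_rademacherSum_mul (u i) (v j)
    calc _ = a i j * (2 ^ n * ∑ k, u i k * v j k) := by
            rw [Finset.mul_sum, Finset.mul_sum]
            exact Finset.sum_congr rfl fun k _ => by ring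
      _ = _ := by
            rw [← this, Finset.mul_sum]
            refine Finset.sum_congr rfl fun ω _ => ?_
            simp only [Y, Z]
            ring
  have : 2 ^ n * ∑ i, ∑ j, a i j * ∑ k, u i k * v j k ≤ 2 ^ n * ((4 * c + B / 2) * S) := by
    rw [key]
    rw [hmS] at hC
    linarith
  exact le_of_mul_le_mul_left this h2

/-- **Grothendieck's inequality** for matrices, with constant `8`. -/
theorem grothendieckBound_eight {a : I → J → ℝ} {c : ℝ}
    (ha : ∀ (s : I → ℝ) (t : J → ℝ), (∀ i, |s i| ≤ 1) → (∀ j, |t j| ≤ 1) →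
      ∑ i, ∑ j, a i j * (s i * t j) ≤ c) :
    GrothendieckBound a (8 * c) := by
  -- `8 * c` is the fixed point of the improvement map, which contracts by the factor `1 / 2`.
  have h : ∀ r : ℕ, GrothendieckBound a
      (8 * c + (1 / 2) ^ r * (∑ i, ∑ j, |a i j| - 8 * c)) := by
    intro r
    induction r with
    | zero => simpa using grothendieckBound_sum_abs a
    | succ r ih =>
      have := ih.improve ha
      convert this using 1
      ring
  intro n S hS u v hu hv
  have ht : Filter.Tendsto
      (fun r : ℕ => (8 * c + (1 / 2 : ℝ) ^ r * (∑ i, ∑ j, |a i j| - 8 * c)) * S) Filter.atTop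
      (nhds ((8 * c + 0 * (∑ i, ∑ j, |a i j| - 8 * c)) * S)) :=
    (((tendsto_pow_atTop_nhds_zero_of_lt_one (by norm_num) (by norm_num)).mul_const _).const_add
      _).mul_const _
  rw [zero_mul, add_zero] at ht
  exact ge_of_tendsto' ht fun r => h r n S hS u v hu hv

end

/-! ### Grothendieck's inequality for `C(K)` -/

section

variable {K : Type*} [TopologicalSpace K] [CompactSpace K]

/-- Finitely many continuous functions on a compact Hausdorff space are uniformly approximated by
their interpolations along a partition of unity. -/
theorem exists_partition_interpolation [T2Space K] {N : Type*} [Fintype N] (y : N → C(K, ℝ))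
    {δ : ℝ} (hδ : 0 < δ) :
    ∃ (s : Finset K) (h : s → C(K, ℝ)), (∀ i t, 0 ≤ h i t) ∧ (∀ t, ∑ i, h i t = 1) ∧
      ∀ k, ‖∑ i : s, y k i • h i - y k‖ ≤ δ := by
  let U : K → Set K := fun p => {t | ∀ k, |y k p - y k t| < δ}
  have hUo : ∀ p, IsOpen (U p) := fun p => by
    simp only [U, Set.ofPred_forall]
    exact isOpen_iInter_of_finite fun k => isOpen_lt (by fun_prop) continuous_const
  obtain ⟨s, hs⟩ := isCompact_univ.elim_finite_subcover U hUo
    fun t _ => Set.mem_iUnion.2 ⟨t, fun k => by simpa using hδ⟩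
  obtain ⟨f, hf⟩ := PartitionOfUnity.exists_isSubordinate isClosed_univ (fun i : s => U i)
    (fun i => hUo i) (fun t ht => by
      obtain ⟨i, hi, hit⟩ := Set.mem_iUnion₂.1 (hs ht)
      exact Set.mem_iUnion.2 ⟨⟨i, hi⟩, hit⟩)
  have hsum : ∀ t, ∑ i, f i t = 1 := fun t => by
    rw [← finsum_eq_sum_of_fintype]; exact f.sum_eq_one (Set.mem_univ t)
  refine ⟨s, fun i => f i, fun i t => f.nonneg i t, hsum, fun k => ?_⟩
  rw [ContinuousMap.norm_le _ hδ.le]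
  intro t
  have h1 : (∑ i : s, y k i • f i - y k) t = ∑ i : s, (y k i - y k t) * f i t := by
    simp only [sub_mul, Finset.sum_sub_distrib, ← Finset.mul_sum, hsum t]
    simp [ContinuousMap.sum_apply]
  rw [h1, Real.norm_eq_abs]
  calc _ ≤ ∑ i : s, |(y k i - y k t) * f i t| := Finset.abs_sum_le_sum_abs _ _
    _ ≤ ∑ i : s, δ * f i t := by
        refine Finset.sum_le_sum fun i _ => ?_
        rw [abs_mul, abs_of_nonneg (f.nonneg i t)]
        by_cases h0 : f i t = 0
        · simp [h0]
        · exact mul_le_mul_of_nonneg_right (hf i (subset_tsupport _ h0) k).le (f.nonneg i t)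
    _ = δ := by rw [← Finset.mul_sum, hsum t, mul_one]

theorem norm_sum_smul_partition_le {ι : Type*} [Fintype ι] {h : ι → C(K, ℝ)}
    (h0 : ∀ i t, 0 ≤ h i t) (h1 : ∀ t, ∑ i, h i t = 1) (s : ι → ℝ) (hs : ∀ i, |s i| ≤ 1) :
    ‖∑ i, s i • h i‖ ≤ 1 := by
  rw [ContinuousMap.norm_le _ zero_le_one]
  intro t
  rw [ContinuousMap.sum_apply, Real.norm_eq_abs, ← h1 t]
  refine (Finset.abs_sum_le_sum_abs _ _).trans (Finset.sum_le_sum fun i _ => ?_)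
  rw [ContinuousMap.smul_apply, smul_eq_mul, abs_mul, abs_of_nonneg (h0 i t)]
  exact mul_le_of_le_one_left (h0 i t) (hs i)

/-- Grothendieck's inequality for the diagonal of a bounded bilinear form on `C(K)`, for functions
interpolated along a partition of unity. -/
theorem sum_abs_bilin_interpolation_le (A : C(K, ℝ) →L[ℝ] C(K, ℝ) →L[ℝ] ℝ)
    {ι : Type*} [Fintype ι] {h : ι → C(K, ℝ)}
    (h0 : ∀ i t, 0 ≤ h i t) (h1 : ∀ t, ∑ i, h i t = 1)
    {N : Type*} [Fintype N] (w : ι → N → ℝ) {S : ℝ} (hS : 0 < S)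
    (hw : ∀ i, ∑ k, w i k ^ 2 ≤ S) :
    ∑ k, |A (∑ i, w i k • h i) (∑ i, w i k • h i)| ≤ 8 * ‖A‖ * S := by
  have hexp : ∀ s t : ι → ℝ, A (∑ i, s i • h i) (∑ i, t i • h i) =
      ∑ i, ∑ j, A (h i) (h j) * (s i * t j) := by
    intro s t
    simp only [map_sum, map_smul, _root_.sum_apply, _root_.smul_apply,
      smul_eq_mul, Finset.mul_sum]
    rw [Finset.sum_comm]
    exact Finset.sum_congr rfl fun i _ => Finset.sum_congr rfl fun j _ => by ring
  have ha : GrothendieckBound (fun i j => A (h i) (h j)) (8 * ‖A‖) := by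
    refine grothendieckBound_eight fun s t hs ht => ?_
    rw [← hexp]
    refine (le_abs_self _).trans ((A.le_opNorm₂ _ _).trans ?_)
    have hs' := norm_sum_smul_partition_le h0 h1 s hs
    have ht' := norm_sum_smul_partition_le h0 h1 t ht
    calc _ ≤ ‖A‖ * 1 * 1 := by gcongr
      _ = _ := by ring
  let σ : N → ℝ := fun k => SignType.sign (A (∑ i, w i k • h i) (∑ i, w i k • h i))
  have hσ : ∀ k, σ k ^ 2 ≤ 1 := fun k => by
    simp only [σ]
    rcases SignType.sign (A (∑ i, w i k • h i) (∑ i, w i k • h i)) <;> simp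
  have := ha.apply hS w (fun i k => σ k * w i k) hw (fun i => by
    refine (Finset.sum_le_sum fun k _ => ?_).trans (hw i)
    rw [mul_pow]
    exact mul_le_of_le_one_left (sq_nonneg _) (hσ k))
  refine le_trans (le_of_eq ?_) this
  simp only [Finset.mul_sum]
  rw [Finset.sum_congr rfl fun i _ => Finset.sum_comm, Finset.sum_comm]
  refine Finset.sum_congr rfl fun k _ => ?_
  rw [← sign_mul_self]
  change σ k * _ = _
  rw [hexp, Finset.mul_sum]
  refine Finset.sum_congr rfl fun i _ => ?_
  rw [Finset.mul_sum]
  exact Finset.sum_congr rfl fun j _ => by ring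

/-- **Grothendieck's inequality** for the diagonal of a bounded bilinear form on `C(K)`. -/
theorem sum_abs_bilin_self_le [T2Space K] (A : C(K, ℝ) →L[ℝ] C(K, ℝ) →L[ℝ] ℝ)
    {N : Type*} [Fintype N] (y : N → C(K, ℝ)) {S : ℝ} (hS : 0 ≤ S)
    (hy : ∀ t, ∑ k, y k t ^ 2 ≤ S) :
    ∑ k, |A (y k) (y k)| ≤ 8 * ‖A‖ * S := by
  refine le_of_forall_pos_le_add fun η hη => ?_
  obtain ⟨S', hS', hc'⟩ : ∃ S', S < S' ∧ 8 * ‖A‖ * S' ≤ 8 * ‖A‖ * S + η := by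
    refine ⟨S + η / (8 * ‖A‖ + 1), by linarith [show 0 < η / (8 * ‖A‖ + 1) by positivity], ?_⟩
    have : (8 * ‖A‖ + 1) * (η / (8 * ‖A‖ + 1)) = η := mul_div_cancel₀ _ (by positivity)
    nlinarith [show 0 < η / (8 * ‖A‖ + 1) by positivity]
  refine le_trans ?_ hc'
  have hcl : IsClosed {z : N → C(K, ℝ) | ∑ k, |A (z k) (z k)| ≤ 8 * ‖A‖ * S'} :=
    isClosed_le (by fun_prop) continuous_const
  refine hcl.closure_subset_iff.2 (Set.Subset.refl _) ?_
  rw [Metric.mem_closure_iff]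
  intro ε hε
  obtain ⟨s, h, h0, h1, h2⟩ := exists_partition_interpolation y (half_pos hε)
  refine ⟨fun k => ∑ i : s, y k i • h i,
    sum_abs_bilin_interpolation_le A h0 h1 (fun (i : s) k => y k i) (hS.trans_lt hS')
      (fun i => (hy i).trans hS'.le), ?_⟩
  rw [dist_comm]
  refine ((dist_pi_le_iff (half_pos hε).le).2 fun k => ?_).trans_lt (half_lt_self hε)
  rw [dist_eq_norm]
  exact h2 k

end

/-! ### Random elements of `C(K)` -/

section

variable {K : Type*} [TopologicalSpace K] [CompactSpace K] [TopologicalSpace.MetrizableSpace K]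
  {Ω : Type*} [MeasurableSpace Ω]

/-- A random function all of whose values are measurable is a strongly measurable random element
of `C(K)`: closed balls are cut out by countably many conditions on point values, and they generate
the Borel σ-algebra of the separable space `C(K)`. -/
theorem stronglyMeasurable_of_eval {X : Ω → C(K, ℝ)} (hX : ∀ t, Measurable fun ω => X ω t) :
    StronglyMeasurable X := by
  let _ := TopologicalSpace.metrizableSpaceMetric K
  let _ : MeasurableSpace C(K, ℝ) := borel _
  have _ : BorelSpace C(K, ℝ) := ⟨rfl⟩
  have hball : ∀ f : C(K, ℝ), Measurable fun ω => dist (X ω) f := by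
    intro f
    refine measurable_of_Iic fun r => ?_
    obtain ⟨D, hDc, hDd⟩ := TopologicalSpace.exists_countable_dense K
    rcases lt_or_ge r 0 with hr | hr
    · convert MeasurableSet.empty
      ext ω
      simpa using hr.trans_le dist_nonneg
    · have : (fun ω => dist (X ω) f) ⁻¹' Set.Iic r = ⋂ t ∈ D, {ω | dist (X ω t) (f t) ≤ r} := by
        ext ω
        simp only [Set.mem_preimage, Set.mem_Iic, Set.mem_iInter, Set.mem_ofPred_eq]
        rw [ContinuousMap.dist_le hr]
        refine ⟨fun h t _ => h t, fun h t => ?_⟩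
        have hc : IsClosed {t | dist (X ω t) (f t) ≤ r} :=
          isClosed_le (by fun_prop) continuous_const
        exact hc.closure_subset_iff.2 h (hDd t)
      rw [this]
      exact MeasurableSet.biInter hDc fun t _ =>
        measurableSet_le ((hX t).dist measurable_const) measurable_const
  refine Measurable.stronglyMeasurable ?_
  refine measurable_of_isOpen fun U hU => ?_
  obtain ⟨D, hDc, hDd⟩ := TopologicalSpace.exists_countable_dense C(K, ℝ)
  have : X ⁻¹' U = ⋃ f ∈ D, ⋃ q ∈ {q : ℚ | Metric.ball f (q : ℝ) ⊆ U},
      {ω | dist (X ω) f < q} := by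
    ext ω
    simp only [Set.mem_preimage, Set.mem_iUnion, Set.mem_ofPred_eq, exists_prop]
    constructor
    · intro h
      obtain ⟨ε, hε, hεU⟩ := Metric.isOpen_iff.1 hU _ h
      obtain ⟨q, hq0, hq⟩ := exists_rat_btwn (half_pos hε)
      obtain ⟨f, hf, hfq⟩ := Metric.dense_iff.1 hDd (X ω) q hq0
      rw [Metric.mem_ball] at hf
      refine ⟨f, hfq, q, fun g hg => hεU ?_, by rwa [dist_comm]⟩
      rw [Metric.mem_ball] at hg ⊢
      linarith [dist_triangle g f (X ω)]
    · rintro ⟨f, _, q, hq, h⟩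
      exact hq h
  rw [this]
  exact MeasurableSet.biUnion hDc fun f _ => MeasurableSet.biUnion (Set.to_countable _)
    fun q _ => measurableSet_lt (hball f) measurable_const

variable {μ : Measure Ω} [IsFiniteMeasure μ]

/-- The moment bound of `lintegral_bilin_self_le` for simple random elements: it is the finite
Grothendieck inequality for the values weighted by the square roots of their probabilities. -/
theorem integral_bilin_self_le_of_simpleFunc (A : C(K, ℝ) →L[ℝ] C(K, ℝ) →L[ℝ] ℝ)
    (Y : SimpleFunc Ω C(K, ℝ)) {S : ℝ} (hS : 0 ≤ S) (hY : ∀ t, ∫ ω, Y ω t ^ 2 ∂μ ≤ S) :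
    ∫ ω, |A (Y ω) (Y ω)| ∂μ ≤ 8 * ‖A‖ * S := by
  have hsum : ∀ g : C(K, ℝ) → ℝ, g 0 = 0 → ∫ ω, g (Y ω) ∂μ =
      ∑ f : Y.range, μ.real (Y ⁻¹' {(f : C(K, ℝ))}) * g f := by
    intro g hg
    rw [Finset.sum_coe_sort Y.range fun f => μ.real (Y ⁻¹' {f}) * g f]
    exact ((Y.map g).integral_eq_integral (SimpleFunc.integrable_of_isFiniteMeasure _)).symm.trans
      (SimpleFunc.map_integral _ _ (SimpleFunc.integrable_of_isFiniteMeasure _) hg)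
  have := sum_abs_bilin_self_le A
    (fun f : Y.range => √(μ.real (Y ⁻¹' {(f : C(K, ℝ))})) • (f : C(K, ℝ))) hS (fun t => by
      refine le_trans (le_of_eq ?_) (hY t)
      rw [hsum (fun f => f t ^ 2) (by simp)]
      refine Finset.sum_congr rfl fun f _ => ?_
      rw [ContinuousMap.smul_apply, smul_eq_mul, mul_pow, Real.sq_sqrt measureReal_nonneg])
  refine le_trans (le_of_eq ?_) this
  rw [hsum (fun f => |A f f|) (by simp)]
  refine Finset.sum_congr rfl fun f _ => ?_
  rw [map_smul, map_smul, smul_apply, smul_eq_mul, smul_eq_mul, ← mul_assoc,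
    Real.mul_self_sqrt measureReal_nonneg, abs_mul, abs_of_nonneg measureReal_nonneg]

/-- The moment bound of `lintegral_bilin_self_le` for bounded random elements, by approximation with
simple ones. The second moments of the point values converge uniformly in the point, because the
approximation is in the norm of `C(K)`. -/
theorem integral_bilin_self_le_of_bounded (A : C(K, ℝ) →L[ℝ] C(K, ℝ) →L[ℝ] ℝ)
    {Y : Ω → C(K, ℝ)} (hm : StronglyMeasurable Y) {M : ℝ} (hM : 0 ≤ M) (hYM : ∀ ω, ‖Y ω‖ ≤ M)
    {S : ℝ} (hS : 0 ≤ S) (hY : ∀ t, ∫ ω, Y ω t ^ 2 ∂μ ≤ S) :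
    ∫ ω, |A (Y ω) (Y ω)| ∂μ ≤ 8 * ‖A‖ * S := by
  set Z := hm.approxBounded M
  have hZM : ∀ n ω, ‖Z n ω‖ ≤ M := hm.norm_approxBounded_le hM
  have hlim : ∀ ω, Filter.Tendsto (fun n => Z n ω) Filter.atTop (nhds (Y ω)) :=
    fun ω => hm.tendsto_approxBounded_of_norm_le (hYM ω)
  have hZm : ∀ n, StronglyMeasurable (Z n) := fun n => (Z n).stronglyMeasurable
  have he : Filter.Tendsto (fun n => ∫ ω, ‖Z n ω - Y ω‖ ∂μ) Filter.atTop (nhds 0) := by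
    have := tendsto_integral_of_dominated_convergence (μ := μ) (F := fun n ω => ‖Z n ω - Y ω‖)
      (f := fun _ => 0) (fun _ => M + M)
      (fun n => ((hZm n).sub hm).norm.aestronglyMeasurable) (integrable_const _)
      (fun n => .of_forall fun ω => by
        rw [norm_norm]
        exact (norm_sub_le _ _).trans (add_le_add (hZM n ω) (hYM ω)))
      (.of_forall fun ω => by
        simpa using ((hlim ω).sub_const (Y ω)).norm)
    simpa using this
  have hA : Filter.Tendsto (fun n => ∫ ω, |A (Z n ω) (Z n ω)| ∂μ) Filter.atTop
      (nhds (∫ ω, |A (Y ω) (Y ω)| ∂μ)) := by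
    have hcont : Continuous fun f : C(K, ℝ) => |A f f| := by fun_prop
    refine tendsto_integral_of_dominated_convergence (fun _ => ‖A‖ * M * M)
      (fun n => (hcont.comp_stronglyMeasurable (hZm n)).aestronglyMeasurable)
      (integrable_const _) (fun n => .of_forall fun ω => ?_)
      (.of_forall fun ω => (hcont.tendsto _).comp (hlim ω))
    rw [Real.norm_eq_abs, abs_abs]
    refine (A.le_opNorm₂ _ _).trans ?_
    have := hZM n ω
    gcongr
  have hbd : ∀ n, ∫ ω, |A (Z n ω) (Z n ω)| ∂μ ≤
      8 * ‖A‖ * (S + 2 * M * ∫ ω, ‖Z n ω - Y ω‖ ∂μ) := by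
    intro n
    refine integral_bilin_self_le_of_simpleFunc A (Z n) (by positivity) fun t => ?_
    have hev : ∀ W : Ω → C(K, ℝ), StronglyMeasurable W → (∀ ω, ‖W ω‖ ≤ M) →
        Integrable (fun ω => W ω t ^ 2) μ := by
      intro W hW hWM
      refine Integrable.of_bound (C := M ^ 2) ?_ (.of_forall fun ω => ?_)
      · exact ((by fun_prop : Continuous fun f : C(K, ℝ) => f t ^ 2).comp_stronglyMeasurable
          hW).aestronglyMeasurable
      · rw [norm_pow]
        exact pow_le_pow_left₀ (norm_nonneg _) (((W ω).norm_coe_le_norm t).trans (hWM ω)) 2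
    have hint : Integrable (fun ω => ‖Z n ω - Y ω‖) μ :=
      Integrable.of_bound (C := M + M) ((hZm n).sub hm).norm.aestronglyMeasurable
        (.of_forall fun ω => by
          rw [norm_norm]
          exact (norm_sub_le _ _).trans (add_le_add (hZM n ω) (hYM ω)))
    calc ∫ ω, Z n ω t ^ 2 ∂μ ≤ ∫ ω, (Y ω t ^ 2 + 2 * M * ‖Z n ω - Y ω‖) ∂μ := by
          refine integral_mono (hev _ (hZm n) (hZM n))
            ((hev _ hm hYM).add (hint.const_mul _)) fun ω => ?_
          have h1 := abs_le.1 (((Z n ω).norm_coe_le_norm t).trans (hZM n ω))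
          have h2 := abs_le.1 (((Y ω).norm_coe_le_norm t).trans (hYM ω))
          have h3 := (Z n ω - Y ω).norm_coe_le_norm t
          rw [ContinuousMap.sub_apply, Real.norm_eq_abs] at h3
          have h4 : |Z n ω t + Y ω t| ≤ 2 * M := by rw [abs_le]; constructor <;> linarith
          have h5 : (Z n ω t + Y ω t) * (Z n ω t - Y ω t) ≤ 2 * M * ‖Z n ω - Y ω‖ := by
            refine (le_abs_self _).trans ?_
            rw [abs_mul]
            gcongr
          dsimp only
          nlinarith
      _ = ∫ ω, Y ω t ^ 2 ∂μ + 2 * M * ∫ ω, ‖Z n ω - Y ω‖ ∂μ := by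
          rw [integral_add (hev _ hm hYM) (hint.const_mul _), integral_const_mul]
      _ ≤ _ := by gcongr; exact hY t
  have hlim' : Filter.Tendsto (fun n => 8 * ‖A‖ * (S + 2 * M * ∫ ω, ‖Z n ω - Y ω‖ ∂μ))
      Filter.atTop (nhds (8 * ‖A‖ * (S + 2 * M * 0))) :=
    ((he.const_mul _).const_add _).const_mul _
  rw [mul_zero, add_zero] at hlim'
  exact le_of_tendsto_of_tendsto' hA hlim' hbd

/-- Grothendieck's inequality for random elements of `C(K)`: the moments of a bounded bilinear form
are controlled by the second moments of the point values. -/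
theorem lintegral_bilin_self_le (A : C(K, ℝ) →L[ℝ] C(K, ℝ) →L[ℝ] ℝ)
    {X : Ω → C(K, ℝ)} (hm : StronglyMeasurable X) {S : ℝ} (hS : 0 ≤ S)
    (hX : ∀ t, ∫⁻ ω, ‖X ω t‖ₑ ^ 2 ∂μ ≤ ENNReal.ofReal S) :
    ∫⁻ ω, ‖A (X ω) (X ω)‖ₑ ∂μ ≤ ENNReal.ofReal (8 * ‖A‖ * S) := by
  let s : ℕ → Set Ω := fun n => {ω | ‖X ω‖ ≤ n}
  have hs : ∀ n, MeasurableSet (s n) := fun n => hm.norm.measurable measurableSet_Iic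
  let Y : ℕ → Ω → C(K, ℝ) := fun n => (s n).indicator X
  have hYm : ∀ n, StronglyMeasurable (Y n) := fun n => hm.indicator (hs n)
  have hYn : ∀ n ω, ‖Y n ω‖ ≤ n := fun n ω => by
    by_cases h : ω ∈ s n
    · rw [show Y n ω = X ω from Set.indicator_of_mem h _]
      exact h
    · simp [Y, h]
  have hcont : Continuous fun f : C(K, ℝ) => A f f := by fun_prop
  have hbd : ∀ n, ∫⁻ ω, ‖A (Y n ω) (Y n ω)‖ₑ ∂μ ≤ ENNReal.ofReal (8 * ‖A‖ * S) := by
    intro n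
    have h1 := integral_bilin_self_le_of_bounded (μ := μ) A (hYm n) n.cast_nonneg (hYn n) hS
      (fun t => by
        have hcm : AEStronglyMeasurable (fun ω => Y n ω t ^ 2) μ :=
          ((by fun_prop : Continuous fun f : C(K, ℝ) => f t ^ 2).comp_stronglyMeasurable
            (hYm n)).aestronglyMeasurable
        rw [integral_eq_lintegral_of_nonneg_ae (.of_forall fun ω => sq_nonneg _) hcm]
        refine ENNReal.toReal_le_of_le_ofReal hS (le_trans (lintegral_mono fun ω => ?_) (hX t))
        rw [← Real.enorm_of_nonneg (sq_nonneg _), enorm_pow]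
        gcongr
        by_cases h : ω ∈ s n <;> simp [Y, h])
    have h2 : Integrable (fun ω => A (Y n ω) (Y n ω)) μ := by
      refine Integrable.of_bound (C := ‖A‖ * n * n)
        (hcont.comp_stronglyMeasurable (hYm n)).aestronglyMeasurable (.of_forall fun ω => ?_)
      refine (A.le_opNorm₂ _ _).trans ?_
      have := hYn n ω
      gcongr
    rw [← ofReal_integral_norm_eq_lintegral_enorm h2]
    exact ENNReal.ofReal_le_ofReal h1
  have hlim : ∀ ω, Filter.liminf (fun n => ‖A (Y n ω) (Y n ω)‖ₑ) Filter.atTop =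
      ‖A (X ω) (X ω)‖ₑ := by
    intro ω
    refine Filter.Tendsto.liminf_eq (tendsto_const_nhds.congr' ?_)
    obtain ⟨N, hN⟩ := exists_nat_ge ‖X ω‖
    filter_upwards [Filter.eventually_ge_atTop N] with n hn
    have : ω ∈ s n := hN.trans (by exact_mod_cast hn)
    simp [Y, this]
  calc _ = ∫⁻ ω, Filter.liminf (fun n => ‖A (Y n ω) (Y n ω)‖ₑ) Filter.atTop ∂μ := by
        simp only [hlim]
    _ ≤ Filter.liminf (fun n => ∫⁻ ω, ‖A (Y n ω) (Y n ω)‖ₑ ∂μ) Filter.atTop :=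
        lintegral_liminf_le fun n =>
          (hcont.comp_stronglyMeasurable (hYm n)).enorm
    _ ≤ _ := by
        refine (Filter.liminf_le_liminf (.of_forall hbd)).trans ?_
        simp

end

/-! ### The two tensor powers -/

namespace BanachMoment

section

variable {k : ℕ} {B : Type*} [NormedAddCommGroup B] [NormedSpace ℝ B]

/-- The elementary tensors of the injective tensor power, as a bounded `k`-linear map. -/
noncomputable def injTprod : ContinuousMultilinearMap ℝ (fun _ : Fin k => B) (injTensorPower k B) :=
  MultilinearMap.mkContinuous
    { toFun := fun x => ⟨elementaryForm x,
        Submodule.le_topologicalClosure _ (Submodule.subset_span ⟨x, rfl⟩)⟩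
      map_update_add' := fun x i a b => by
        ext φ
        change elementaryForm _ φ = elementaryForm _ φ + elementaryForm _ φ
        simp only [elementaryForm_apply]
        exact ((MultilinearMap.mkPiAlgebra ℝ (Fin k) ℝ).compLinearMap
          fun j => (φ j).toLinearMap).map_update_add x i a b
      map_update_smul' := fun x i c a => by
        ext φ
        change elementaryForm _ φ = c • elementaryForm _ φ
        simp only [elementaryForm_apply]
        exact ((MultilinearMap.mkPiAlgebra ℝ (Fin k) ℝ).compLinearMap
          fun j => (φ j).toLinearMap).map_update_smul x i c a }
    1 fun x => by
      rw [one_mul]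
      refine ContinuousMultilinearMap.opNorm_le_bound (by positivity) fun φ => ?_
      change ‖elementaryForm x φ‖ ≤ _
      rw [elementaryForm_apply, norm_prod, ← Finset.prod_mul_distrib]
      refine Finset.prod_le_prod (fun i _ => norm_nonneg _) fun i _ => ?_
      rw [mul_comm]
      exact (φ i).le_opNorm (x i)

instance : CompleteSpace (injTensorPower k B) :=
  (Submodule.isClosed_topologicalClosure _).completeSpace_coe

/-- The canonical bounded map from the projective to the injective tensor power. -/
noncomputable def projToInj : ProjTensorPower k B →L[ℝ] injTensorPower k B :=
  (PiTensorProduct.liftIsometry ℝ _ _ injTprod).extend UniformSpace.Completion.toComplL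

theorem projToInj_projPow (x : B) : projToInj (projPow k x) = injPow k x := by
  have := (PiTensorProduct.liftIsometry ℝ _ _ (injTprod (k := k) (B := B))).extend_eq
    (e := UniformSpace.Completion.toComplL (𝕜 := ℝ)) UniformSpace.Completion.denseRange_coe
    (UniformSpace.Completion.isUniformInducing_coe _) (⨂ₜ[ℝ] _, x)
  refine this.trans ?_
  rw [PiTensorProduct.liftIsometry_apply_apply]
  simp
  rfl

theorem continuous_projPow : Continuous (projPow k : B → ProjTensorPower k B) :=
  (UniformSpace.Completion.continuous_coe _).comp
    ((PiTensorProduct.tprodL ℝ (E := fun _ : Fin k => B)).cont.comp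
      (continuous_pi fun _ => continuous_id))

theorem norm_projPow_le (x : B) : ‖projPow k x‖ ≤ ‖x‖ ^ k := by
  rw [projPow, UniformSpace.Completion.norm_coe]
  simpa using PiTensorProduct.projectiveSeminorm_tprod_le (𝕜 := ℝ) fun _ : Fin k => x

/-- Evaluation of the elements of the injective tensor power, which are `k`-linear forms. -/
noncomputable def injEval (φ : Fin k → StrongDual ℝ B) : StrongDual ℝ (injTensorPower k B) :=
  (ContinuousMultilinearMap.apply ℝ (fun _ : Fin k => StrongDual ℝ B) ℝ φ).comp
    (injTensorPower k B).subtypeL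

theorem injEval_apply (φ : Fin k → StrongDual ℝ B) (u : injTensorPower k B) :
    injEval φ u = (u : ContinuousMultilinearMap ℝ (fun _ : Fin k => StrongDual ℝ B) ℝ) φ := rfl

theorem injEval_injPow (φ : Fin k → StrongDual ℝ B) (x : B) :
    injEval φ (injPow k x) = ∏ i, φ i x :=
  elementaryForm_apply k (fun _ => x) φ

theorem norm_injEval_le (φ : Fin k → StrongDual ℝ B) : ‖injEval φ‖ ≤ ∏ i, ‖φ i‖ := by
  refine ContinuousLinearMap.opNorm_le_bound _ (by positivity) fun u => ?_
  rw [injEval_apply, mul_comm]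
  exact ContinuousMultilinearMap.le_opNorm _ _

/-- The bounded bilinear form on `B` that corresponds to a functional on the projective tensor
square. -/
noncomputable def bilinOfDual (Φ : StrongDual ℝ (ProjTensorPower 2 B)) : B →L[ℝ] B →L[ℝ] ℝ :=
  let F : MultilinearMap ℝ (fun _ : Fin 2 => B) ℝ :=
    (Φ.toLinearMap.comp (UniformSpace.Completion.toComplL (𝕜 := ℝ)
      (E := ⨂[ℝ] _ : Fin 2, B)).toLinearMap).compMultilinearMap (PiTensorProduct.tprod ℝ)
  have h (x y : B) : ![x, y] = Function.update ![x, 0] 1 y := by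
    ext i; fin_cases i <;> rfl
  LinearMap.mkContinuous₂
    (LinearMap.mk₂ ℝ (fun x y => F ![x, y]) (fun x x' y => F.cons_add ![y] x x')
      (fun c x y => F.cons_smul ![y] c x)
      (fun x y y' => by rw [h x (y + y'), h x y, h x y', F.map_update_add])
      (fun c x y => by rw [h x (c • y), h x y, F.map_update_smul]))
    ‖Φ‖ fun x y => by
      refine (Φ.le_opNorm _).trans ?_
      rw [mul_assoc]
      refine mul_le_mul_of_nonneg_left ?_ (norm_nonneg _)
      refine (UniformSpace.Completion.norm_coe _).trans_le ?_
      simpa using PiTensorProduct.projectiveSeminorm_tprod_le (𝕜 := ℝ) ![x, y]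

theorem bilinOfDual_self (Φ : StrongDual ℝ (ProjTensorPower 2 B)) (x : B) :
    bilinOfDual Φ x x = Φ (projPow 2 x) := by
  have h : ![x, x] = fun _ : Fin 2 => x := by ext i; fin_cases i <;> rfl
  change Φ (UniformSpace.Completion.toComplL (PiTensorProduct.tprod ℝ ![x, x])) = _
  rw [h]
  rfl

theorem norm_bilinOfDual_le (Φ : StrongDual ℝ (ProjTensorPower 2 B)) : ‖bilinOfDual Φ‖ ≤ ‖Φ‖ := by
  unfold bilinOfDual
  exact LinearMap.mkContinuous₂_norm_le _ (norm_nonneg _) _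

end

/-! ### Dunford and Pettis integrability -/

section

variable {Ω : Type*} [MeasurableSpace Ω] {P : Measure Ω}
  {E F : Type*} [NormedAddCommGroup E] [NormedSpace ℝ E] [NormedAddCommGroup F] [NormedSpace ℝ F]

theorem DunfordIntegrable.clm_comp {Y : Ω → E} (h : DunfordIntegrable Y P) (T : E →L[ℝ] F) :
    DunfordIntegrable (fun ω => T (Y ω)) P :=
  fun φ => h (φ.comp T)

theorem PettisIntegrable.clm_comp {Y : Ω → E} (h : PettisIntegrable Y P) (T : E →L[ℝ] F) :
    PettisIntegrable (fun ω => T (Y ω)) P := by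
  refine ⟨h.1.clm_comp T, fun A hA => ?_⟩
  obtain ⟨y, hy⟩ := h.2 A hA
  exact ⟨T y, fun φ => hy (φ.comp T)⟩

theorem BochnerIntegrable.clm_comp {Y : Ω → E} (h : BochnerIntegrable Y P) (T : E →L[ℝ] F) :
    BochnerIntegrable (fun ω => T (Y ω)) P :=
  T.integrable_comp h

/-- A strongly measurable Dunford integrable function is Pettis integrable if its compositions with
the functionals in the unit ball are uniformly integrable: the Bochner integrals of its truncations
converge in norm to the Pettis integral. -/
theorem DunfordIntegrable.pettisIntegrable [CompleteSpace E] [IsFiniteMeasure P] {Y : Ω → E}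
    (h : DunfordIntegrable Y P) (hm : StronglyMeasurable Y)
    (hu : ∀ ε : ℝ, 0 < ε → ∃ δ : ℝ, 0 < δ ∧ ∀ s, MeasurableSet s → P s ≤ ENNReal.ofReal δ →
      ∀ φ : StrongDual ℝ E, ∫⁻ ω in s, ‖φ (Y ω)‖ₑ ∂P ≤ ENNReal.ofReal (ε * ‖φ‖)) :
    PettisIntegrable Y P := by
  refine ⟨h, fun A hA => ?_⟩
  -- The truncations are `Y` on the events `b n`.
  let b : ℕ → Set Ω := fun n => {ω | ‖Y ω‖ ≤ n}
  have hb : ∀ n, MeasurableSet (b n) := fun n => hm.norm.measurable measurableSet_Iic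
  have hbm : Monotone b := fun n m hnm ω (hω : ‖Y ω‖ ≤ n) =>
    show ‖Y ω‖ ≤ m from hω.trans (by exact_mod_cast hnm)
  have hbU : ⋃ n, b n = Set.univ := Set.eq_univ_of_forall fun ω =>
    Set.mem_iUnion.2 (exists_nat_ge ‖Y ω‖)
  have hint : ∀ n, IntegrableOn Y (A ∩ b n) P := fun n =>
    Integrable.of_bound (C := n) hm.aestronglyMeasurable
      ((ae_restrict_iff' (hA.inter (hb n))).2 (.of_forall fun ω hω => hω.2))
  let y : ℕ → E := fun n => ∫ ω in A ∩ b n, Y ω ∂P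
  have hφy : ∀ (φ : StrongDual ℝ E) n, φ (y n) = ∫ ω in A ∩ b n, φ (Y ω) ∂P := fun φ n =>
    (φ.integral_comp_comm (hint n)).symm
  have hlim : ∀ φ : StrongDual ℝ E, Filter.Tendsto (fun n => φ (y n)) Filter.atTop
      (nhds (∫ ω in A, φ (Y ω) ∂P)) := by
    intro φ
    have := tendsto_setIntegral_of_monotone (μ := P) (f := fun ω => φ (Y ω))
      (s := fun n => A ∩ b n) (fun n => hA.inter (hb n))
      (fun n m hnm => Set.inter_subset_inter_right _ (hbm hnm)) (h φ).integrableOn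
    rw [← Set.inter_iUnion, hbU, Set.inter_univ] at this
    simpa only [hφy] using this
  have htail : Filter.Tendsto (fun n => P (b n)ᶜ) Filter.atTop (nhds 0) := by
    have := tendsto_measure_iInter_atTop (μ := P) (s := fun n => (b n)ᶜ)
      (fun n => (hb n).compl.nullMeasurableSet)
      (fun n m hnm => Set.compl_subset_compl.2 (hbm hnm)) ⟨0, measure_ne_top _ _⟩
    rwa [← Set.compl_iUnion, hbU, Set.compl_univ, measure_empty] at this
  have hcau : CauchySeq y := by
    refine Metric.cauchySeq_iff'.2 fun ε hε => ?_
    obtain ⟨δ, hδ, H⟩ := hu (ε / 2) (half_pos hε)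
    obtain ⟨N, hN⟩ := (htail.eventually_le_const (ENNReal.ofReal_pos.2 hδ)).exists
    refine ⟨N, fun n hn => ?_⟩
    rw [dist_eq_norm]
    refine lt_of_le_of_lt ?_ (half_lt_self hε)
    refine NormedSpace.norm_le_dual_bound (𝕜 := ℝ) _ (half_pos hε).le fun φ => ?_
    have hsub : A ∩ b N ⊆ A ∩ b n := Set.inter_subset_inter_right _ (hbm hn)
    rw [map_sub, hφy, hφy, ← setIntegral_sdiff (hA.inter (hb N)) (h φ).integrableOn hsub]
    have hd : MeasurableSet ((A ∩ b n) \ (A ∩ b N)) := (hA.inter (hb n)).diff (hA.inter (hb N))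
    have h1 := H _ hd ((measure_mono fun ω hω => fun hN => hω.2 ⟨hω.1.1, hN⟩).trans hN) φ
    refine (norm_integral_le_lintegral_norm _).trans ?_
    refine ENNReal.toReal_le_of_le_ofReal (by positivity) ?_
    simpa only [ofReal_norm] using h1
  obtain ⟨z, hz⟩ := cauchySeq_tendsto_of_complete hcau
  exact ⟨z, fun φ => tendsto_nhds_unique ((φ.continuous.tendsto z).comp hz) (hlim φ)⟩

/-- If the weak second moment of `X` exists, then it is bounded on bounded sets of functionals: the
map `φ ↦ φ(X)` into `L²` has closed graph. -/
theorem exists_lintegral_sq_le_of_weakMomentExists {X : Ω → E}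
    (hm : StronglyMeasurable X) (h : WeakMomentExists 2 X P) :
    ∃ C : NNReal, ∀ φ : StrongDual ℝ E, ‖φ‖ ≤ 1 → ∫⁻ ω, ‖φ (X ω)‖ₑ ^ 2 ∂P ≤ C := by
  have hL : ∀ φ : StrongDual ℝ E, MemLp (fun ω => φ (X ω)) 2 P := fun φ =>
    (memLp_two_iff_integrable_sq
      (φ.continuous.comp_stronglyMeasurable hm).aestronglyMeasurable).2
      (by simpa [sq] using h fun _ => φ)
  let g : StrongDual ℝ E →ₗ[ℝ] Lp ℝ 2 P :=
    { toFun := fun φ => (hL φ).toLp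
      map_add' := fun φ ψ => MemLp.toLp_add (hL φ) (hL ψ)
      map_smul' := fun c φ => MemLp.toLp_const_smul c (hL φ) }
  have hg : Continuous g := by
    refine g.continuous_of_seq_closed_graph fun φ ψ f hφ hf => ?_
    obtain ⟨ns, hns, hae⟩ := (tendstoInMeasure_of_tendsto_Lp hf).exists_seq_tendsto_ae
    refine Lp.ext ?_
    have hall : ∀ᵐ ω ∂P, ∀ n, g (φ n) ω = φ n (X ω) :=
      ae_all_iff.2 fun n => (hL (φ n)).coeFn_toLp
    filter_upwards [hae, hall, (hL ψ).coeFn_toLp] with ω h1 h2 h3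
    refine tendsto_nhds_unique h1 ?_
    have h4 : g ψ ω = ψ (X ω) := h3
    rw [h4]
    have h5 : Filter.Tendsto (fun n => φ (ns n) (X ω)) Filter.atTop (nhds (ψ (X ω))) :=
      (((ContinuousLinearMap.apply ℝ ℝ (X ω)).continuous.tendsto ψ).comp hφ).comp hns.tendsto_atTop
    simpa only [Function.comp_apply, h2] using h5
  let G : StrongDual ℝ E →L[ℝ] Lp ℝ 2 P := ⟨g, hg⟩
  refine ⟨‖G‖₊ ^ 2, fun φ hφ => ?_⟩
  have h1 : ‖G φ‖ₑ ≤ ‖G‖₊ := by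
    rw [enorm_eq_nnnorm, ENNReal.coe_le_coe]
    exact (G.le_opNorm φ).trans (mul_le_of_le_one_right (norm_nonneg _) hφ)
  have h2 : ‖G φ‖ₑ = eLpNorm (fun ω => φ (X ω)) 2 P := Lp.enorm_toLp (hf := hL φ)
  have h3 : ∫⁻ ω, ‖φ (X ω)‖ₑ ^ 2 ∂P = eLpNorm (fun ω => φ (X ω)) 2 P ^ 2 := by
    have := eLpNorm_nnreal_pow_eq_lintegral (μ := P) (f := fun ω => φ (X ω)) (p := 2) (by norm_num)
    simpa using this.symm
  rw [h3, ← h2, ENNReal.coe_pow]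
  gcongr

end

end BanachMoment

/-! ### Second moments of random elements of `C(K)` -/

namespace BanachMoment

theorem eLpNorm_indicator_abs_sq {Ω : Type*} [MeasurableSpace Ω] {P : Measure Ω} (ξ : Ω → ℝ)
    {s : Set Ω} (hs : MeasurableSet s) :
    eLpNorm (s.indicator fun ω => |ξ ω| ^ 2) 1 P = ∫⁻ ω in s, ‖ξ ω‖ₑ ^ 2 ∂P := by
  rw [eLpNorm_one_eq_lintegral_enorm, ← lintegral_indicator hs]
  refine lintegral_congr fun ω => ?_
  by_cases h : ω ∈ s <;> simp [h, enorm_pow]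

theorem eLpNorm_abs_sq {Ω : Type*} [MeasurableSpace Ω] {P : Measure Ω} (ξ : Ω → ℝ) :
    eLpNorm (fun ω => |ξ ω| ^ 2) 1 P = ∫⁻ ω, ‖ξ ω‖ₑ ^ 2 ∂P := by
  simpa using eLpNorm_indicator_abs_sq (P := P) ξ MeasurableSet.univ

section

variable {K : Type*} [TopologicalSpace K] [CompactSpace K]

theorem norm_evalCLM_le_one (t : K) : ‖(ContinuousMap.evalCLM ℝ t : StrongDual ℝ C(K, ℝ))‖ ≤ 1 :=
  ContinuousLinearMap.opNorm_le_bound _ zero_le_one fun f => by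
    rw [one_mul]; exact f.norm_coe_le_norm t

/-- The functional `u ↦ u(δ_t, δ_t)` on the injective tensor square of `C(K)`, that is, the value of
the continuous function `u` on `K × K` at a point of the diagonal. -/
noncomputable def diagEval (t : K) : StrongDual ℝ (injTensorPower 2 C(K, ℝ)) :=
  injEval fun _ => ContinuousMap.evalCLM ℝ t

theorem diagEval_injPow (t : K) (f : C(K, ℝ)) : diagEval t (injPow 2 f) = f t ^ 2 := by
  rw [diagEval, injEval_injPow]
  simp

theorem norm_diagEval_le (t : K) : ‖diagEval t‖ ≤ 1 := by
  refine (norm_injEval_le _).trans ?_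
  exact Finset.prod_le_one (fun _ _ => norm_nonneg _) fun _ _ => norm_evalCLM_le_one t

/-- Elementary tensors give continuous functions on the diagonal, and uniform limits of continuous
functions are continuous. -/
theorem continuous_diagEval (u : injTensorPower 2 C(K, ℝ)) : Continuous fun t => diagEval t u := by
  obtain ⟨u, hu⟩ := u
  have hspan : ∀ v ∈ Submodule.span ℝ (Set.range (elementaryForm (k := 2) (B := C(K, ℝ)))),
      Continuous fun t : K => v fun _ => ContinuousMap.evalCLM ℝ t := by
    intro v hv
    induction hv using Submodule.span_induction with
    | mem v hv =>
      obtain ⟨x, rfl⟩ := hv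
      simp only [elementaryForm_apply]
      exact continuous_finsetProd _ fun i _ => (x i).continuous
    | zero => exact continuous_const
    | add v w _ _ hv hw => exact hv.add hw
    | smul c v _ hv => exact hv.const_smul c
  change Continuous fun t : K => u fun _ => ContinuousMap.evalCLM ℝ t
  refine continuous_of_uniform_approx_of_continuous fun W hW => ?_
  obtain ⟨ε, hε, hεW⟩ := Metric.mem_uniformity_dist.1 hW
  obtain ⟨v, hv, huv⟩ := Metric.mem_closure_iff.1 hu ε hε
  refine ⟨_, hspan v hv, fun t => hεW ?_⟩
  refine lt_of_le_of_lt ?_ huv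
  rw [dist_eq_norm, dist_eq_norm]
  refine ((u - v).le_opNorm fun _ => ContinuousMap.evalCLM ℝ t).trans ?_
  exact mul_le_of_le_one_right (norm_nonneg _)
    (Finset.prod_le_one (fun _ _ => norm_nonneg _) fun _ _ => norm_evalCLM_le_one t)

theorem enorm_sq_le_enorm_injPow (f : C(K, ℝ)) : ‖f‖ₑ ^ 2 ≤ ‖injPow 2 f‖ₑ := by
  have h : ‖f‖ ^ 2 ≤ ‖injPow 2 f‖ := by
    refine (Real.le_sqrt (norm_nonneg _) (norm_nonneg _)).1 ?_
    rw [ContinuousMap.norm_le _ (Real.sqrt_nonneg _)]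
    intro t
    refine (Real.le_sqrt (norm_nonneg _) (norm_nonneg _)).2 ?_
    rw [Real.norm_eq_abs, sq_abs, ← diagEval_injPow]
    refine (le_abs_self _).trans (((diagEval t).le_opNorm _).trans ?_)
    exact mul_le_of_le_one_left (norm_nonneg _) (norm_diagEval_le t)
  rw [← ofReal_norm, ← ofReal_norm, ← ENNReal.ofReal_pow (norm_nonneg _)]
  exact ENNReal.ofReal_le_ofReal h

variable {Ω : Type*} [MeasurableSpace Ω] {P : Measure Ω} {X : Ω → C(K, ℝ)}

/-- If the weak second moment exists, then the second moments of the point values are bounded. -/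
theorem WeakMomentExists.iSup_lintegral_sq_lt_top (hm : StronglyMeasurable X)
    (h : WeakMomentExists 2 X P) : ⨆ t, ∫⁻ ω, ‖X ω t‖ₑ ^ 2 ∂P < ∞ := by
  obtain ⟨C, hC⟩ := exists_lintegral_sq_le_of_weakMomentExists hm h
  refine lt_of_le_of_lt (iSup_le fun t => ?_) (ENNReal.coe_lt_top (r := C))
  exact hC (ContinuousMap.evalCLM ℝ t) (norm_evalCLM_le_one t)

theorem DunfordIntegrable.weakMomentExists_of_injPow
    {B : Type*} [NormedAddCommGroup B] [NormedSpace ℝ B] {k : ℕ} {X : Ω → B}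
    (h : DunfordIntegrable (fun ω => injPow k (X ω)) P) : WeakMomentExists k X P :=
  fun φ => by simpa only [injEval_injPow] using h (injEval φ)

/-- Pettis integrability of `X ⊗ X` in the injective tensor square makes `t ↦ 𝔼 (1_A |X(t)|²)`
continuous for every event `A`. By Dini's theorem these functions tend to `0` uniformly along every
decreasing sequence of events with null intersection, and the tails of a sequence of events with
summable probabilities form such a sequence. -/
theorem PettisIntegrable.unifIntegrable_of_injPow [IsFiniteMeasure P]
    (h : PettisIntegrable (fun ω => injPow 2 (X ω)) P) :
    UnifIntegrable (fun (t : K) (ω : Ω) => |X ω t| ^ 2) 1 P := by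
  have hint : ∀ t, Integrable (fun ω => X ω t ^ 2) P := fun t => by
    simpa only [diagEval_injPow] using h.1 (diagEval t)
  have hcont : ∀ A, MeasurableSet A → Continuous fun t => ∫ ω in A, X ω t ^ 2 ∂P := by
    intro A hA
    obtain ⟨y, hy⟩ := h.2 A hA
    refine (continuous_diagEval y).congr fun t => ?_
    simpa only [diagEval_injPow] using hy (diagEval t)
  have hlin : ∀ t (A : Set Ω), ∫⁻ ω in A, ‖X ω t‖ₑ ^ 2 ∂P =
      ENNReal.ofReal (∫ ω in A, X ω t ^ 2 ∂P) := by
    intro t A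
    rw [ofReal_integral_eq_lintegral_ofReal (hint t).integrableOn
      (.of_forall fun ω => sq_nonneg _)]
    refine lintegral_congr fun ω => ?_
    rw [← enorm_pow, Real.enorm_of_nonneg (sq_nonneg _)]
  intro ε hε
  by_contra hcon
  push Not at hcon
  have hsel : ∀ n : ℕ, ∃ (t : K) (s : Set Ω), MeasurableSet s ∧
      P s ≤ ENNReal.ofReal ((1 / 2) ^ n) ∧ ε < ∫ ω in s, X ω t ^ 2 ∂P := by
    intro n
    obtain ⟨t, s, hs, hPs, hlt⟩ := hcon ((1 / 2) ^ n) (by positivity)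
    rw [eLpNorm_indicator_abs_sq (fun ω => X ω t) hs, hlin] at hlt
    exact ⟨t, s, hs, hPs, (ENNReal.ofReal_lt_ofReal_iff_of_nonneg hε.le).1 hlt⟩
  choose t s hs hPs hlt using hsel
  -- The tails `b n = ⋃ m ≥ n, s m`; their intersection is null by Borel–Cantelli.
  let b : ℕ → Set Ω := fun n => ⋃ m, ⋃ _ : n ≤ m, s m
  have hb : ∀ n, MeasurableSet (b n) := fun n =>
    MeasurableSet.iUnion fun m => MeasurableSet.iUnion fun _ => hs m
  have hanti : Antitone b := fun n n' hn => Set.iUnion_mono fun m =>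
    Set.iUnion_subset fun hm => Set.subset_iUnion (fun _ : n ≤ m => s m) (hn.trans hm)
  have hsb : ∀ n, s n ⊆ b n := fun n => Set.subset_iUnion₂ (s := fun m (_ : n ≤ m) => s m) n le_rfl
  have hnull : P (⋂ n, b n) = 0 := by
    have hfin : ∑' n, P (s n) ≠ ∞ := by
      refine ne_top_of_le_ne_top ?_ (ENNReal.tsum_le_tsum hPs)
      rw [← ENNReal.ofReal_tsum_of_nonneg (fun n => by positivity) summable_geometric_two]
      exact ENNReal.ofReal_ne_top
    have := measure_limsup_atTop_eq_zero hfin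
    rwa [Filter.limsup_eq_iInf_iSup_of_nat] at this
  have hunif := Antitone.tendstoUniformly_of_forall_tendsto
    (F := fun n (t : K) => ∫ ω in b n, X ω t ^ 2 ∂P) (f := fun _ => 0)
    (fun n => hcont _ (hb n))
    (fun n n' hn t => setIntegral_mono_set (hint t).integrableOn
      (.of_forall fun ω => sq_nonneg _) (hanti hn).eventuallyLE)
    continuous_const
    (fun t => by
      have := tendsto_setIntegral_of_antitone (μ := P) (f := fun ω => X ω t ^ 2) hb hanti
        ⟨0, (hint t).integrableOn⟩
      rwa [Measure.restrict_eq_zero.2 hnull, integral_zero_measure] at this)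
  obtain ⟨n, hn⟩ := (Metric.tendstoUniformly_iff.1 hunif ε hε).exists
  have h1 := hn (t n)
  rw [Real.dist_eq, zero_sub, abs_neg] at h1
  have h2 : ∫ ω in s n, X ω (t n) ^ 2 ∂P ≤ ∫ ω in b n, X ω (t n) ^ 2 ∂P :=
    setIntegral_mono_set (hint _).integrableOn (.of_forall fun ω => sq_nonneg _)
      (hsb n).eventuallyLE
  linarith [hlt n, le_abs_self (∫ ω in b n, X ω (t n) ^ 2 ∂P)]

section Metrizable

variable [TopologicalSpace.MetrizableSpace K] [IsFiniteMeasure P]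

theorem lintegral_dual_projPow_le (hm : StronglyMeasurable X) {s : Set Ω} {S : ℝ} (hS : 0 ≤ S)
    (hX : ∀ t, ∫⁻ ω in s, ‖X ω t‖ₑ ^ 2 ∂P ≤ ENNReal.ofReal S)
    (Φ : StrongDual ℝ (ProjTensorPower 2 C(K, ℝ))) :
    ∫⁻ ω in s, ‖Φ (projPow 2 (X ω))‖ₑ ∂P ≤ ENNReal.ofReal (8 * ‖Φ‖ * S) := by
  simp only [← bilinOfDual_self]
  refine (lintegral_bilin_self_le (bilinOfDual Φ) hm hS hX).trans (ENNReal.ofReal_le_ofReal ?_)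
  have := norm_bilinOfDual_le Φ
  gcongr

theorem dunfordIntegrable_projPow (hm : StronglyMeasurable X)
    (h : ⨆ t, ∫⁻ ω, ‖X ω t‖ₑ ^ 2 ∂P < ∞) :
    DunfordIntegrable (fun ω => projPow 2 (X ω)) P := by
  intro Φ
  refine ⟨((Φ.continuous.comp continuous_projPow).comp_stronglyMeasurable hm).aestronglyMeasurable,
    ?_⟩
  have := lintegral_dual_projPow_le (P := P) (s := Set.univ) hm ENNReal.toReal_nonneg
    (fun t => by
      rw [Measure.restrict_univ, ENNReal.ofReal_toReal h.ne]
      exact le_iSup (fun t => ∫⁻ ω, ‖X ω t‖ₑ ^ 2 ∂P) t) Φ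
  rw [Measure.restrict_univ] at this
  exact this.trans_lt ENNReal.ofReal_lt_top

theorem pettisIntegrable_projPow (hm : StronglyMeasurable X)
    (h : UniformIntegrable (fun (t : K) (ω : Ω) => |X ω t| ^ 2) 1 P) :
    PettisIntegrable (fun ω => projPow 2 (X ω)) P := by
  obtain ⟨-, hu, C, hC⟩ := h
  have hsup : ⨆ t, ∫⁻ ω, ‖X ω t‖ₑ ^ 2 ∂P < ∞ := by
    refine (iSup_le fun t => ?_).trans_lt (ENNReal.coe_lt_top (r := C))
    rw [← eLpNorm_abs_sq fun ω => X ω t]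
    exact hC t
  refine (dunfordIntegrable_projPow hm hsup).pettisIntegrable
    (continuous_projPow.comp_stronglyMeasurable hm) fun ε hε => ?_
  obtain ⟨δ, hδ, H⟩ := hu (show 0 < ε / 8 by positivity)
  refine ⟨δ, hδ, fun s hs hPs Φ => ?_⟩
  refine (lintegral_dual_projPow_le hm (show 0 ≤ ε / 8 by positivity) (fun t => ?_) Φ).trans
    (le_of_eq ?_)
  · rw [← eLpNorm_indicator_abs_sq (fun ω => X ω t) hs]
    exact H t s hs hPs
  · congr 1; ring

end Metrizable

theorem bochnerIntegrable_projPow (hm : StronglyMeasurable X)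
    (h : ∫⁻ ω, (⨆ t, ‖X ω t‖ₑ) ^ 2 ∂P < ∞) :
    BochnerIntegrable (fun ω => projPow 2 (X ω)) P := by
  refine ⟨(continuous_projPow.comp_stronglyMeasurable hm).aestronglyMeasurable,
    (lintegral_mono fun ω => ?_).trans_lt h⟩
  rw [← ContinuousMap.enorm_eq_iSup_enorm, ← ofReal_norm, ← ofReal_norm,
    ← ENNReal.ofReal_pow (norm_nonneg _)]
  exact ENNReal.ofReal_le_ofReal (norm_projPow_le _)

theorem BochnerIntegrable.lintegral_iSup_sq_lt_top
    (h : BochnerIntegrable (fun ω => injPow 2 (X ω)) P) :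
    ∫⁻ ω, (⨆ t, ‖X ω t‖ₑ) ^ 2 ∂P < ∞ := by
  refine (lintegral_mono fun ω => ?_).trans_lt h.2
  rw [← ContinuousMap.enorm_eq_iSup_enorm]
  exact enorm_sq_le_enorm_injPow _

end

end BanachMoment

theorem theorem9p15 {K : Type*} [TopologicalSpace K] [CompactSpace K]
    [TopologicalSpace.MetrizableSpace K]
    {Ω : Type*} [MeasurableSpace Ω] (P : Measure Ω) [IsProbabilityMeasure P]
    (X : Ω → C(K, ℝ)) (hX : ∀ t : K, Measurable fun ω => X ω t) :
    ((BanachMoment.DunfordIntegrable (fun ω => BanachMoment.projPow 2 (X ω)) P ↔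
        BanachMoment.DunfordIntegrable (fun ω => BanachMoment.injPow 2 (X ω)) P) ∧
      (BanachMoment.DunfordIntegrable (fun ω => BanachMoment.injPow 2 (X ω)) P ↔
        BanachMoment.WeakMomentExists 2 X P) ∧
      (BanachMoment.WeakMomentExists 2 X P ↔
        (⨆ t : K, ∫⁻ ω, ‖X ω t‖ₑ ^ 2 ∂P) < ∞)) ∧
    ((BanachMoment.PettisIntegrable (fun ω => BanachMoment.projPow 2 (X ω)) P ↔
        BanachMoment.PettisIntegrable (fun ω => BanachMoment.injPow 2 (X ω)) P) ∧
      (BanachMoment.PettisIntegrable (fun ω => BanachMoment.injPow 2 (X ω)) P ↔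
        UniformIntegrable (fun (t : K) (ω : Ω) => |X ω t| ^ 2) 1 P)) ∧
    ((BanachMoment.BochnerIntegrable (fun ω => BanachMoment.projPow 2 (X ω)) P ↔
        BanachMoment.BochnerIntegrable (fun ω => BanachMoment.injPow 2 (X ω)) P) ∧
      (BanachMoment.BochnerIntegrable (fun ω => BanachMoment.injPow 2 (X ω)) P ↔
        (∫⁻ ω, (⨆ t : K, ‖X ω t‖ₑ) ^ 2 ∂P) < ∞)) := by
  have hm : StronglyMeasurable X := stronglyMeasurable_of_eval hX
  have hT : ∀ ω, BanachMoment.injPow 2 (X ω) =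
      BanachMoment.projToInj (BanachMoment.projPow 2 (X ω)) :=
    fun ω => (BanachMoment.projToInj_projPow _).symm
  have dunfordProjInj
      (h : BanachMoment.DunfordIntegrable (fun ω => BanachMoment.projPow 2 (X ω)) P) :
      BanachMoment.DunfordIntegrable (fun ω => BanachMoment.injPow 2 (X ω)) P := by
    simpa only [hT] using h.clm_comp BanachMoment.projToInj
  have pettisProjInj
      (h : BanachMoment.PettisIntegrable (fun ω => BanachMoment.projPow 2 (X ω)) P) :
      BanachMoment.PettisIntegrable (fun ω => BanachMoment.injPow 2 (X ω)) P := by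
    simpa only [hT] using h.clm_comp BanachMoment.projToInj
  have bochnerProjInj
      (h : BanachMoment.BochnerIntegrable (fun ω => BanachMoment.projPow 2 (X ω)) P) :
      BanachMoment.BochnerIntegrable (fun ω => BanachMoment.injPow 2 (X ω)) P := by
    simpa only [hT] using h.clm_comp BanachMoment.projToInj
  have pettisUnif (h : BanachMoment.PettisIntegrable (fun ω => BanachMoment.injPow 2 (X ω)) P) :
      UniformIntegrable (fun (t : K) (ω : Ω) => |X ω t| ^ 2) 1 P := by
    have hsup := h.1.weakMomentExists_of_injPow.iSup_lintegral_sq_lt_top hm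
    refine ⟨fun t => ((hX t).abs.pow_const 2).aestronglyMeasurable, h.unifIntegrable_of_injPow,
      (⨆ t : K, ∫⁻ ω, ‖X ω t‖ₑ ^ 2 ∂P).toNNReal, fun t => ?_⟩
    rw [ENNReal.coe_toNNReal hsup.ne]
    refine (BanachMoment.eLpNorm_abs_sq fun ω => X ω t).trans_le ?_
    exact le_iSup (fun t => ∫⁻ ω, ‖X ω t‖ₑ ^ 2 ∂P) t
  refine ⟨⟨⟨dunfordProjInj, fun h => ?_⟩, ⟨fun h => h.weakMomentExists_of_injPow, fun h => ?_⟩,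
    ⟨fun h => h.iSup_lintegral_sq_lt_top hm, fun h => ?_⟩⟩,
    ⟨⟨pettisProjInj, fun h => ?_⟩, ⟨pettisUnif, fun h => ?_⟩⟩,
    ⟨bochnerProjInj, fun h => ?_⟩, ⟨fun h => h.lintegral_iSup_sq_lt_top, fun h => ?_⟩⟩
  · exact BanachMoment.dunfordIntegrable_projPow hm
      (h.weakMomentExists_of_injPow.iSup_lintegral_sq_lt_top hm)
  · exact dunfordProjInj (BanachMoment.dunfordIntegrable_projPow hm
      (h.iSup_lintegral_sq_lt_top hm))
  · exact (dunfordProjInj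
      (BanachMoment.dunfordIntegrable_projPow hm h)).weakMomentExists_of_injPow
  · exact BanachMoment.pettisIntegrable_projPow hm (pettisUnif h)
  · exact pettisProjInj (BanachMoment.pettisIntegrable_projPow hm h)
  · exact BanachMoment.bochnerIntegrable_projPow hm h.lintegral_iSup_sq_lt_top
  · exact bochnerProjInj (BanachMoment.bochnerIntegrable_projPow hm h)
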